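/- **Corollary 3.4.** Let $\Psi\in C^2((0,\infty))$ be the available energy and let $p(\rho)=\rho\Psi'(\rho)-\Psi(\rho)$ be the corresponding pressure. Let $m\in\mathbb R$, put $\Psi^m(\rho)=\Psi(\rho)-\frac{m^2}{2\rho}$ for $\rho>0$, and assume that there are $0<\rho_g^m<\rho_\ell^m$ such that the graph of $\Psi^m$ has a bitangent line through $(\rho_g^m,\Psi^m(\rho_g^m))$ and $(\rho_\ell^m,\Psi^m(\rho_\ell^m))$ and lies strictly above this line in a neighbourhood of $[\rho_g^m,\rho_\ell^m]$ except at $\rho_g^m$ and $\rho_\ell^m$. Let $\rho_*\in(\rho_g^m,\rho_\ell^m)$. Then there is a constant $\varepsilon_0>0$, depending only on $\Psi$, $m$, $\rho_g^m$, $\rho_\ell^m$ and $\rho_*$, such that for all $\varepsilon>0$ and $\omega>0$ with $\varepsilon/\omega^2<\varepsilon_0$ and every speed $c\in\mathbb R$ there is a classical solution $(\rho,q)$, $\rho>0$, of the one-dimensional Euler–Korteweg equations with constant Korteweg parameter $\varepsilon$, $$\partial_t\rho+\partial_x q=0,\qquad \partial_t q+\partial_x\Big(\frac{q^2}{\rho}\Big)+\partial_x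 p(\rho)=\rho\,\partial_x(\varepsilon\,\partial_x^2\rho)\qquad\text{in }\mathbb R\times(0,\infty),$$ ($\rho$ of class $C^3$, $q$ of class $C^1$) which * is a traveling wave with speed $c$, i.e. $\rho(x,t)=\bar\rho(x-ct)$ and $q(x,t)=\bar q(x-ct)$ for some profiles $\bar\rho,\bar q$; * is $\omega$-periodic in $x$ and has average density $\frac1\omega\int_0^\omega\rho(x,t)\,dx=\rho_*$ for every $t>0$; * exhibits a phase transition, i.e. its mass flux $j=q-c\rho$ is not identically zero; * is non-trivial: at every time $t>0$ neither the density $\rho(\cdot,t)$ nor the velocity $u=q/\rho$ is constant in $x$. If $m\ne0$, the solution can be chosen so that in addition $j\equiv m$. -/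

import Mathlib

open Set

namespace EulerKorteweg

/-- The pressure `p(r) = r Ψ'(r) - Ψ(r)` belonging to the volume specific available energy `Ψ`
(used for `r > 0` only). -/
noncomputable def pressure (Ψ : ℝ → ℝ) (r : ℝ) : ℝ := r * deriv Ψ r - Ψ r

/-- The modified energy `Ψ^m(r) = Ψ(r) - m² / (2 r)` (used for `r > 0` only). -/
noncomputable def modifiedEnergy (Ψ : ℝ → ℝ) (m r : ℝ) : ℝ := Ψ r - m ^ 2 / (2 * r)

/-- The graph of `Φ` (a function on `(0, ∞)`) has a bitangent line through `(a, Φ a)` and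
`(b, Φ b)`, `0 < a < b`, and lies strictly above this line on a neighbourhood of `[a, b]`,
except at `a` and `b`. -/
structure HasBitangent (Φ : ℝ → ℝ) (a b : ℝ) : Prop where
  left_pos : 0 < a
  lt : a < b
  deriv_eq : deriv Φ b = deriv Φ a
  value_eq : Φ b = Φ a + deriv Φ a * (b - a)
  above : ∃ δ > 0, ∀ r, 0 < r → a - δ < r → r < b + δ → r ≠ a → r ≠ b →
    Φ a + deriv Φ a * (r - a) < Φ r

/-- `(ρ, q)`, with density `ρ x t > 0` and momentum `q x t`, is a classical solution in
`ℝ × (0, ∞)` of the one-dimensional isothermal Euler-Korteweg equations (no viscosity, constant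
Korteweg parameter `ε`, available energy `Ψ`)

`∂ₜ ρ + ∂ₓ q = 0`,  `∂ₜ q + ∂ₓ (q² / ρ) + ∂ₓ (p(ρ)) = ρ ∂ₓ (ε ∂ₓ² ρ)`. -/
structure IsSolution (Ψ : ℝ → ℝ) (ε : ℝ) (ρ q : ℝ → ℝ → ℝ) : Prop where
  density_pos : ∀ x t, 0 < t → 0 < ρ x t
  density_smooth : ContDiffOn ℝ 3 (fun z : ℝ × ℝ => ρ z.1 z.2) (univ ×ˢ Ioi 0)
  momentum_smooth : ContDiffOn ℝ 1 (fun z : ℝ × ℝ => q z.1 z.2) (univ ×ˢ Ioi 0)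
  mass : ∀ x t, 0 < t →
    deriv (fun s => ρ x s) t + deriv (fun y => q y t) x = 0
  momentum : ∀ x t, 0 < t →
    deriv (fun s => q x s) t + deriv (fun y => q y t ^ 2 / ρ y t) x
        + deriv (fun y => pressure Ψ (ρ y t)) x
      = ρ x t * deriv (fun y => ε * iteratedDeriv 2 (fun z => ρ z t) y) x

/-- `(ρ, q)` is a traveling wave with speed `c`: it is given by profile functions of `x - c t`. -/
def IsTravelingWave (c : ℝ) (ρ q : ℝ → ℝ → ℝ) : Prop :=
  ∃ R Q : ℝ → ℝ, ∀ x t, 0 < t → ρ x t = R (x - c * t) ∧ q x t = Q (x - c * t)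

/-- `(ρ, q)` is periodic in space with period `ω`. -/
def IsSpacePeriodic (ω : ℝ) (ρ q : ℝ → ℝ → ℝ) : Prop :=
  ∀ x t, 0 < t → ρ (x + ω) t = ρ x t ∧ q (x + ω) t = q x t

/-- The mass flux `j = ρ u - ρ c = q - ρ c` through a wave of speed `c`. -/
def massFlux (c : ℝ) (ρ q : ℝ → ℝ → ℝ) (x t : ℝ) : ℝ := q x t - ρ x t * c

/-- A traveling wave with speed `c` has phase transition when its mass flux is not identically
zero. -/
def HasPhaseTransition (c : ℝ) (ρ q : ℝ → ℝ → ℝ) : Prop :=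
  ¬ ∀ x t, 0 < t → massFlux c ρ q x t = 0

/-- `f` is not constant in space, at any positive time. -/
def NonConstantInSpace (f : ℝ → ℝ → ℝ) : Prop :=
  ∀ t, 0 < t → ¬ ∃ a, ∀ x, f x t = a

end EulerKorteweg

/-!
A traveling wave with speed `c` and mass flux `j` has momentum `q = c ρ + j`, and the momentum
equation, divided by `ρ` and integrated once, becomes the oscillator `ε R'' = Φ'(R) - l` for the
modified energy `Φ(R) = Ψ(R) - j² / (2 R)` and some constant `l` (`isSolution_of_profile`). Scaling
the period to one replaces `ε` by `η = ε / ω²`. A profile is found by minimizing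
`∫ (η/2 u'² + V(u))` over periodic `u` with average `r = ρ_*`, where `V` is the distance of `Φ` to
the bitangent, a double well with minimal value zero, extended to the line with frozen slopes
(`HasBitangent.exists_isDoubleWell`). The multiplier of the average constraint is `l`.

* *Existence.* Profiles are written `u x = r + ⟪k x, f⟫`, with `k` a curve in `ℓ²` whose Gram kernel
  is the Green function of `-d²/dx²` on the circle (`inner_greenCurve`); then the energy is
  `η/2 ‖f‖² + ∫ V(u)`. Uniform compactness of the profiles and the parallelogram law give a
  minimizer (`exists_minimizer_profileEnergy`). Testing the weak Euler-Lagrange equation with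
  `k y` expresses `u` through the Green function, so that `u` is a classical solution
  (`classical_of_eulerLagrange`).
* *Smallness.* A trapezoid between the two wells has arbitrarily small potential energy and an
  `η`-term that vanishes as `η → 0` (`exists_trapezoid`). So the minimizer has small energy, and
  since its average lies strictly between the wells, it comes close to both of them at points of
  small energy density (`IsDoubleWell.exists_point_near_left`); in particular it is not constant.
  Comparing the first integral of the oscillator at two such points shows that `l` is small, hence
  smaller than the slopes of `V` outside the wells, and the maximum principle keeps `u` in the range
  where `V` has not been modified (`IsDoubleWell.exists_periodic_solution`).
* *Zero flux.* If `m = 0`, a flux `j ≠ 0` is still needed. All estimates tolerate a small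
  perturbation `t g` of the potential, so a small `j` with `t = j²` is used
  (`HasBitangent.exists_profile`).
-/

open Set

namespace EulerKorteweg

open Filter Topology MeasureTheory intervalIntegral
open scoped RealInnerProductSpace BoundedContinuousFunction

/-! ### The direct method for profile energies -/

section Variational

variable {H : Type*} [NormedAddCommGroup H] [InnerProductSpace ℝ H]

/-- The energy `η/2 ‖f‖² + ∫₀¹ V (r + ⟪k x, f⟫) dx`. The vector `f` of the Hilbert space encodes the
mean-zero part `x ↦ ⟪k x, f⟫` of a profile with average `r`. -/
noncomputable def profileEnergy (k : ℝ → H) (η : ℝ) (V : ℝ → ℝ) (r : ℝ) (f : H) : ℝ :=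
  η / 2 * ‖f‖ ^ 2 + ∫ x in (0 : ℝ)..1, V (r + ⟪k x, f⟫)

/-- The restriction of `x ↦ ⟪k x, f⟫` to the unit interval. -/
noncomputable def profileOnIcc (k : ℝ → H) (hk : Continuous k) (f : H) : Icc (0 : ℝ) 1 →ᵇ ℝ :=
  BoundedContinuousFunction.mkOfCompact ⟨fun x => ⟪k x, f⟫, by fun_prop⟩

theorem isCompact_closure_profileOnIcc (k : ℝ → H) (hk : Continuous k) (R : ℝ) :
    IsCompact (closure (profileOnIcc k hk '' {f | ‖f‖ ≤ R})) := by
  obtain ⟨C, hC⟩ := (isCompact_Icc (a := (0 : ℝ)) (b := 1)).exists_bound_of_continuousOn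
    hk.continuousOn
  refine BoundedContinuousFunction.arzela_ascoli (Icc (-(C * R)) (C * R)) isCompact_Icc _ ?_ ?_
  · rintro _ x ⟨f, hf, rfl⟩
    have h1 : |⟪k x, f⟫| ≤ C * R := (abs_real_inner_le_norm _ _).trans
      (mul_le_mul (hC x x.2) hf (norm_nonneg _) ((norm_nonneg _).trans (hC x x.2)))
    exact abs_le.mp h1
  · have hu := CompactSpace.uniformContinuous_of_continuous
      (hk.comp (continuous_subtype_val (p := fun x => x ∈ Icc (0 : ℝ) 1)))
    rw [Metric.uniformContinuous_iff] at hu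
    intro x
    rw [Metric.equicontinuousAt_iff]
    intro e he
    obtain ⟨d, hd, H1⟩ := hu (e / (|R| + 1)) (by positivity)
    refine ⟨d, hd, fun y hy => ?_⟩
    rintro ⟨_, f, hf, rfl⟩
    have h2 : dist ⟪k x, f⟫ ⟪k y, f⟫ ≤ dist (k x) (k y) * ‖f‖ := by
      rw [Real.dist_eq, ← inner_sub_left, dist_eq_norm]
      exact abs_real_inner_le_norm _ _
    have h3 : dist (k x) (k y) < e / (|R| + 1) := by
      have := H1 hy
      rwa [dist_comm] at this
    have h4 : ‖f‖ < |R| + 1 := by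
      have h5 : ‖f‖ ≤ R := hf
      linarith [le_abs_self R]
    calc dist ⟪k x, f⟫ ⟪k y, f⟫ ≤ dist (k x) (k y) * ‖f‖ := h2
      _ ≤ dist (k x) (k y) * (|R| + 1) := by gcongr
      _ < e / (|R| + 1) * (|R| + 1) := by gcongr
      _ = e := by field_simp

/-- The direct method. The potential term is continuous along a minimizing sequence because the
profiles of a bounded sequence have a uniformly convergent subsequence; the parallelogram law then
makes the sequence itself Cauchy, so no weak topology is needed. -/
theorem exists_minimizer_profileEnergy [CompleteSpace H] (k : ℝ → H) (hk : Continuous k)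
    {η : ℝ} (hη : 0 < η) {V : ℝ → ℝ} (hV : Continuous V) {B : ℝ} (hB : ∀ s, -B ≤ V s) (r : ℝ) :
    ∃ f, ∀ g, profileEnergy k η V r f ≤ profileEnergy k η V r g := by
  set J := profileEnergy k η V r with hJ
  set G : (Icc (0 : ℝ) 1 →ᵇ ℝ) → ℝ := fun ψ =>
    ∫ x in (0 : ℝ)..1, V (r + ψ (projIcc 0 1 zero_le_one x)) with hG
  have hGc : Continuous G := by
    apply continuous_parametric_intervalIntegral_of_continuous'
    have h1 : Continuous fun p : (Icc (0 : ℝ) 1 →ᵇ ℝ) × ℝ =>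
        p.1 (projIcc 0 1 zero_le_one p.2) :=
      continuous_fst.eval (continuous_projIcc.comp continuous_snd)
    exact hV.comp (continuous_const.add h1)
  have hJG : ∀ f, J f = η / 2 * ‖f‖ ^ 2 + G (profileOnIcc k hk f) := by
    intro f
    simp only [hJ, hG, profileEnergy]
    congr 1
    apply integral_congr
    intro x hx
    rw [uIcc_of_le zero_le_one] at hx
    simp [profileOnIcc, projIcc_of_mem zero_le_one hx]
  have hGB : ∀ ψ, -B ≤ G ψ := by
    intro ψ
    have h1 : ∫ _ in (0 : ℝ)..1, -B ≤ G ψ := by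
      apply integral_mono_on zero_le_one (by simp)
      · apply Continuous.intervalIntegrable
        exact hV.comp (continuous_const.add (ψ.continuous.comp continuous_projIcc))
      · intro x _
        exact hB _
    simpa using h1
  have hbdd : BddBelow (range J) := by
    refine ⟨-B, ?_⟩
    rintro _ ⟨f, rfl⟩
    rw [hJG]
    have := hGB (profileOnIcc k hk f)
    have : 0 ≤ η / 2 * ‖f‖ ^ 2 := by positivity
    linarith
  set I := sInf (range J) with hI
  have hle : ∀ f, I ≤ J f := fun f => csInf_le hbdd ⟨f, rfl⟩
  obtain ⟨v, -, hvI, hvm⟩ := exists_seq_tendsto_sInf (range_nonempty J) hbdd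
  choose F hF using hvm
  have hvJ : Tendsto (fun n => J (F n)) atTop (𝓝 I) := by simpa only [hF] using hvI
  obtain ⟨C, hC⟩ := hvJ.bddAbove_range
  have hbound : ∀ n, ‖F n‖ ≤ Real.sqrt ((C + B) * 2 / η) := by
    intro n
    apply Real.le_sqrt_of_sq_le
    rw [le_div_iff₀ hη]
    have h1 : J (F n) ≤ C := hC ⟨n, rfl⟩
    rw [hJG] at h1
    have := hGB (profileOnIcc k hk (F n))
    linarith
  obtain ⟨ψ, -, φ, hφ, hlim⟩ := (isCompact_closure_profileOnIcc k hk _).tendsto_subseq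
    (fun n => subset_closure ⟨F n, hbound n, rfl⟩)
  set P := profileOnIcc k hk with hP
  have hadd : ∀ f g, P ((1 / 2 : ℝ) • (f + g)) = (1 / 2 : ℝ) • (P f + P g) := by
    intro f g
    ext x
    simp [hP, profileOnIcc, inner_smul_right, inner_add_right]
  have hcauchy : CauchySeq (F ∘ φ) := by
    rw [cauchySeq_iff_tendsto_dist_atTop_0]
    have h1 : Tendsto (fun p : ℕ × ℕ => P (F (φ p.1))) atTop (𝓝 ψ) :=
      hlim.comp (by rw [← prod_atTop_atTop_eq]; exact tendsto_fst)
    have h2 : Tendsto (fun p : ℕ × ℕ => P (F (φ p.2))) atTop (𝓝 ψ) :=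
      hlim.comp (by rw [← prod_atTop_atTop_eq]; exact tendsto_snd)
    have h3 := ((h1.add h2).const_smul (1 / 2 : ℝ))
    have h4 : (1 / 2 : ℝ) • (ψ + ψ) = ψ := by
      ext x
      simp
      ring
    rw [h4] at h3
    have g1 := (hGc.tendsto ψ).comp h1
    have g2 := (hGc.tendsto ψ).comp h2
    have g3 := (hGc.tendsto ψ).comp h3
    have hsub := hvJ.comp hφ.tendsto_atTop
    have j1 : Tendsto (fun p : ℕ × ℕ => J (F (φ p.1))) atTop (𝓝 I) :=
      hsub.comp (by rw [← prod_atTop_atTop_eq]; exact tendsto_fst)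
    have j2 : Tendsto (fun p : ℕ × ℕ => J (F (φ p.2))) atTop (𝓝 I) :=
      hsub.comp (by rw [← prod_atTop_atTop_eq]; exact tendsto_snd)
    -- By the parallelogram law `η/4 ‖f - g‖² = J f + J g - 2 J m - (G f + G g - 2 G m)`, where `m` is
    -- the midpoint of `f` and `g`; here `J m ≥ I`.
    have key := (((j1.sub_const I).add (j2.sub_const I)).sub
      ((g1.add g2).sub (g3.const_mul 2))).const_mul (4 / η)
    have hz : 4 / η * (I - I + (I - I) - (G ψ + G ψ - 2 * G ψ)) = 0 := by ring
    rw [hz] at key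
    have hsq : Tendsto (fun p : ℕ × ℕ => dist ((F ∘ φ) p.1) ((F ∘ φ) p.2) ^ 2) atTop (𝓝 0) := by
      refine squeeze_zero (fun _ => by positivity) (fun p => ?_) key
      have e1 := hJG (F (φ p.1))
      have e2 := hJG (F (φ p.2))
      have e3 := hJG ((1 / 2 : ℝ) • (F (φ p.1) + F (φ p.2)))
      have e4 := hle ((1 / 2 : ℝ) • (F (φ p.1) + F (φ p.2)))
      rw [hadd, norm_smul] at e3
      have par := parallelogram_law_with_norm ℝ (F (φ p.1)) (F (φ p.2))
      simp only [Function.comp_apply, dist_eq_norm]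
      rw [div_mul_eq_mul_div, le_div_iff₀ hη]
      rw [Real.norm_of_nonneg (by norm_num)] at e3
      linear_combination (-4) * e1 - 4 * e2 + 8 * e3 + 8 * e4 + η * par
    have := hsq.sqrt
    simpa [Real.sqrt_sq dist_nonneg] using this
  obtain ⟨f, hf⟩ := cauchySeq_tendsto_of_complete hcauchy
  have hJc : Continuous J := by
    refine Continuous.add (by fun_prop) ?_
    apply continuous_parametric_intervalIntegral_of_continuous'
    apply hV.comp
    fun_prop
  have hJf : J f = I := tendsto_nhds_unique ((hJc.tendsto f).comp hf)
    (hvJ.comp hφ.tendsto_atTop)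
  exact ⟨f, fun g => hJf ▸ hle g⟩

/-- The Euler-Lagrange equation in weak form. -/
theorem eulerLagrange_profileEnergy (k : ℝ → H) (hk : Continuous k)
    {η : ℝ} {V V' : ℝ → ℝ} (hV : ∀ s, HasDerivAt V (V' s) s) (hV' : Continuous V') {r : ℝ} {f : H}
    (hf : ∀ g, profileEnergy k η V r f ≤ profileEnergy k η V r g) (g : H) :
    η * ⟪f, g⟫ + ∫ x in (0 : ℝ)..1, V' (r + ⟪k x, f⟫) * ⟪k x, g⟫ = 0 := by
  have hVc : Continuous V := continuous_iff_continuousAt.mpr fun s => (hV s).continuousAt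
  have hF'c : Continuous fun p : ℝ × ℝ => V' (r + ⟪k p.2, f + p.1 • g⟫) * ⟪k p.2, g⟫ := by
    refine Continuous.mul (hV'.comp ?_) ?_ <;> fun_prop
  obtain ⟨C, hC⟩ := ((isCompact_Icc (a := (-1 : ℝ)) (b := 1)).prod
    (isCompact_Icc (a := (0 : ℝ)) (b := 1))).exists_bound_of_continuousOn hF'c.continuousOn
  have h1 : HasDerivAt (fun s : ℝ => ∫ x in (0 : ℝ)..1, V (r + ⟪k x, f + s • g⟫))
      (∫ x in (0 : ℝ)..1, V' (r + ⟪k x, f + (0 : ℝ) • g⟫) * ⟪k x, g⟫) 0 := by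
    refine (intervalIntegral.hasDerivAt_integral_of_dominated_loc_of_deriv_le
      (F' := fun s x => V' (r + ⟪k x, f + s • g⟫) * ⟪k x, g⟫)
      (bound := fun _ => C) (Icc_mem_nhds (by norm_num : (-1 : ℝ) < 0) zero_lt_one)
      ?_ ?_ ?_ ?_ ?_ ?_).2
    · refine Eventually.of_forall fun s => Continuous.aestronglyMeasurable ?_
      apply hVc.comp
      fun_prop
    · apply Continuous.intervalIntegrable
      apply hVc.comp
      fun_prop
    · apply Continuous.aestronglyMeasurable
      exact hF'c.comp (continuous_const.prodMk continuous_id)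
    · refine Eventually.of_forall fun x hx s hs => hC (s, x) ⟨hs, ?_⟩
      rw [uIoc_of_le zero_le_one] at hx
      exact Ioc_subset_Icc_self hx
    · simp
    · refine Eventually.of_forall fun x _ s _ => ?_
      have h2 : HasDerivAt (fun s : ℝ => r + ⟪k x, f + s • g⟫) ⟪k x, g⟫ s := by
        simp only [inner_add_right, inner_smul_right]
        simpa using (((hasDerivAt_id s).mul_const ⟪k x, g⟫).const_add ⟪k x, f⟫).const_add r
      exact (hV _).comp s h2
  have h3 : HasDerivAt (fun s : ℝ => η / 2 * ‖f + s • g‖ ^ 2) (η * ⟪f, g⟫) 0 := by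
    have h4 : (fun s : ℝ => η / 2 * ‖f + s • g‖ ^ 2) =
        fun s : ℝ => η / 2 * (‖f‖ ^ 2 + s * (2 * ⟪f, g⟫) + s ^ 2 * ‖g‖ ^ 2) := by
      funext s
      rw [norm_add_sq_real, inner_smul_right, norm_smul, mul_pow, Real.norm_eq_abs, sq_abs]
      ring
    rw [h4]
    have h5 := ((((hasDerivAt_id (0 : ℝ)).mul_const (2 * ⟪f, g⟫)).const_add (‖f‖ ^ 2)).add
      (((hasDerivAt_id (0 : ℝ)).pow 2).mul_const (‖g‖ ^ 2))).const_mul (η / 2)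
    convert! h5 using 1
    simp
    ring
  have h6 : IsLocalMin (fun s : ℝ => profileEnergy k η V r (f + s • g)) 0 :=
    Eventually.of_forall fun s => by simpa using hf _
  have h7 := h6.hasDerivAt_eq_zero (h3.add h1)
  simpa using h7

end Variational

/-! ### The Green function of the circle -/

theorem summable_modeCoeff_sq (x : ℝ) :
    Summable fun n : ℕ => ‖Complex.exp ((2 * Real.pi * n * x : ℝ) * Complex.I) /
      ((Real.sqrt 2 * Real.pi * n : ℝ) : ℂ)‖ ^ (2 : ENNReal).toReal := by
  have h := (Real.summable_one_div_nat_pow (p := 2)).mpr one_lt_two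
  refine (h.mul_left (1 / (2 * Real.pi ^ 2))).congr fun n => ?_
  rw [norm_div, Complex.norm_exp_ofReal_mul_I, Complex.norm_real, ENNReal.toReal_ofNat,
    Real.rpow_ofNat, div_pow, Real.norm_eq_abs, sq_abs, mul_pow, mul_pow, Real.sq_sqrt (by norm_num)]
  simp only [one_div, mul_inv, one_pow]

/-- The curve in `ℓ²(ℕ, ℂ)`, regarded as a real Hilbert space, with coordinates
`exp (2πinx) / (√2 π n)`; the coordinate `n = 0` vanishes, being a division by zero. -/
noncomputable def greenCurve (x : ℝ) : lp (fun _ : ℕ => ℂ) 2 :=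
  ⟨fun n => Complex.exp ((2 * Real.pi * n * x : ℝ) * Complex.I) /
    ((Real.sqrt 2 * Real.pi * n : ℝ) : ℂ), memℓp_gen (summable_modeCoeff_sq x)⟩

/-- The Gram kernel of `greenCurve` is the mean-zero Green function of `-d²/dx²` on the circle of
length one, half the second Bernoulli polynomial of the distance. -/
theorem inner_greenCurve {x y : ℝ} (h : |x - y| ≤ 1) :
    ⟪greenCurve x, greenCurve y⟫ = (|x - y| ^ 2 - |x - y| + 1 / 6) / 2 := by
  have h1 := lp.hasSum_inner (𝕜 := ℝ) (greenCurve x) (greenCurve y)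
  have h2 := (hasSum_one_div_nat_pow_mul_cos one_ne_zero (x := |x - y|) ⟨abs_nonneg _, h⟩).mul_left
    (1 / (2 * Real.pi ^ 2))
  have h3 : ∀ n : ℕ, ⟪greenCurve x n, greenCurve y n⟫ =
      1 / (2 * Real.pi ^ 2) * (1 / (n : ℝ) ^ (2 * 1) * Real.cos (2 * Real.pi * n * |x - y|)) := by
    intro n
    have e1 : Real.cos (2 * Real.pi * n * |x - y|) = Real.cos (2 * Real.pi * n * x) *
        Real.cos (2 * Real.pi * n * y) +
        Real.sin (2 * Real.pi * n * x) * Real.sin (2 * Real.pi * n * y) := by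
      rw [← Real.cos_sub, ← mul_sub]
      have e2 : 2 * Real.pi * n * |x - y| = |2 * Real.pi * n * (x - y)| := by
        rw [abs_mul, abs_of_nonneg (a := 2 * Real.pi * n) (by positivity)]
      rw [e2, Real.cos_abs]
    rw [e1]
    simp only [greenCurve, Complex.inner, Complex.div_ofReal_re, Complex.div_ofReal_im,
      Complex.exp_ofReal_mul_I_re, Complex.exp_ofReal_mul_I_im, Complex.mul_re, Complex.conj_re,
      Complex.conj_im]
    have e3 : Real.sqrt 2 ^ 2 = 2 := Real.sq_sqrt (by norm_num)
    rcases eq_or_ne (n : ℝ) 0 with hn | hn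
    · simp [hn]
    · have := Real.pi_ne_zero
      have : Real.sqrt 2 ≠ 0 := by positivity
      field_simp
      rw [e3]
      ring
  have h4 := h1.unique (h2.congr_fun h3)
  rw [h4]
  have h5 : (Polynomial.map (algebraMap ℚ ℝ) (Polynomial.bernoulli (2 * 1))).eval |x - y| =
      |x - y| ^ 2 - |x - y| + 6⁻¹ := bernoulliFun_two |x - y|
  rw [h5]
  have := Real.pi_ne_zero
  norm_num
  field_simp

theorem continuous_greenCurve : Continuous greenCurve := by
  rw [continuous_iff_continuousAt]
  intro y
  rw [ContinuousAt, tendsto_iff_norm_sub_tendsto_zero]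
  have h1 : Tendsto (fun x : ℝ => Real.sqrt (|x - y| - |x - y| ^ 2)) (𝓝 y) (𝓝 0) := by
    have : Continuous fun x : ℝ => Real.sqrt (|x - y| - |x - y| ^ 2) := by fun_prop
    simpa using this.tendsto y
  refine h1.congr' ?_
  filter_upwards [Metric.ball_mem_nhds y one_pos] with x hx
  rw [Metric.mem_ball, Real.dist_eq] at hx
  rw [← Real.sqrt_sq (norm_nonneg (greenCurve x - greenCurve y)), norm_sub_sq_real,
    ← real_inner_self_eq_norm_sq, ← real_inner_self_eq_norm_sq, inner_greenCurve hx.le,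
    inner_greenCurve (by simp), inner_greenCurve (by simp)]
  congr 1
  simp
  ring

theorem periodic_greenCurve : Function.Periodic greenCurve 1 := by
  intro x
  ext n
  simp only [greenCurve]
  congr 1
  rw [Complex.exp_eq_exp_iff_exists_int]
  refine ⟨n, ?_⟩
  push_cast
  ring

/-- A continuous periodic function with vanishing mean has a periodic primitive with vanishing
mean. -/
theorem exists_periodic_primitive {g : ℝ → ℝ} (hg : Continuous g) (hp : Function.Periodic g 1)
    (h0 : ∫ x in (0 : ℝ)..1, g x = 0) :
    ∃ G : ℝ → ℝ, (∀ x, HasDerivAt G (g x) x) ∧ Function.Periodic G 1 ∧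
      ∫ x in (0 : ℝ)..1, G x = 0 := by
  set A : ℝ → ℝ := fun x => ∫ t in (0 : ℝ)..x, g t with hA
  have hd : ∀ x, HasDerivAt A (g x) x := fun x =>
    integral_hasDerivAt_right (hg.intervalIntegrable _ _)
      (hg.stronglyMeasurableAtFilter _ _) hg.continuousAt
  have hAc : Continuous A := continuous_iff_continuousAt.mpr fun x => (hd x).continuousAt
  refine ⟨fun x => A x - ∫ t in (0 : ℝ)..1, A t, fun x => (hd x).sub_const _, fun x => ?_, ?_⟩
  · have h1 : A (x + 1) = A x + ∫ t in x..x + 1, g t :=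
      (integral_add_adjacent_intervals (hg.intervalIntegrable _ _)
        (hg.intervalIntegrable _ _)).symm
    have h2 := hp.intervalIntegral_add_eq x 0
    rw [zero_add, h0] at h2
    simp [h1, h2]
  · rw [integral_sub (hAc.intervalIntegrable _ _) (by simp)]
    simp

/-- The Green representation on the circle: if `w` is the mean-zero periodic solution of
`w'' = h - ∫ h`, then pairing `h` with the Green function based at `y` gives `-w y`. -/
theorem integral_mul_inner_greenCurve {h w w' : ℝ → ℝ} {l : ℝ} (hc : Continuous h)
    (hp : Function.Periodic h 1)
    (hw : ∀ x, HasDerivAt w (w' x) x) (hw' : ∀ x, HasDerivAt w' (h x - l) x)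
    (pw : Function.Periodic w 1) (pw' : Function.Periodic w' 1)
    (h0 : ∫ x in (0 : ℝ)..1, w x = 0) (y : ℝ) :
    ∫ x in (0 : ℝ)..1, h x * ⟪greenCurve x, greenCurve y⟫ = -w y := by
  have hwc : Continuous w := continuous_iff_continuousAt.mpr fun x => (hw x).continuousAt
  have hper : Function.Periodic (fun x => h x * ⟪greenCurve x, greenCurve y⟫) 1 := by
    intro x
    simp only [hp x, periodic_greenCurve x]
  -- On the period starting at `y` the Green function is a single polynomial in `x - y`.
  have h1 := hper.intervalIntegral_add_eq 0 y
  rw [zero_add] at h1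
  rw [h1]
  have h2 : ∫ x in y..y + 1, h x * ⟪greenCurve x, greenCurve y⟫ =
      ∫ x in y..y + 1, h x * (((x - y) ^ 2 - (x - y) + 1 / 6) / 2) := by
    apply integral_congr
    intro x hx
    rw [uIcc_of_le (by linarith)] at hx
    have : |x - y| = x - y := abs_of_nonneg (by linarith [hx.1])
    simp only
    rw [inner_greenCurve (by rw [this]; linarith [hx.2]), this]
  -- Two integrations by parts, packaged as one primitive.
  have h3 : ∫ x in y..y + 1, (h x * (((x - y) ^ 2 - (x - y) + 1 / 6) / 2) - w x) = -w y := by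
    have hder : ∀ x ∈ uIcc y (y + 1), HasDerivAt
        (fun x => w' x * (((x - y) ^ 2 - (x - y) + 1 / 6) / 2) - w x * (x - y - 1 / 2)
          + l * ((x - y) ^ 3 / 6 - (x - y) ^ 2 / 4 + (x - y) / 12))
        (h x * (((x - y) ^ 2 - (x - y) + 1 / 6) / 2) - w x) x := by
      intro x _
      have d0 : HasDerivAt (fun x => x - y) 1 x := (hasDerivAt_id x).sub_const y
      have d1 := (hw' x).mul ((((d0.pow 2).sub d0).add_const (1 / 6)).div_const 2)
      have d2 := (hw x).mul (d0.sub_const (1 / 2))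
      have d3 := ((((d0.pow 3).div_const 6).sub ((d0.pow 2).div_const 4)).add
        (d0.div_const 12)).const_mul l
      convert! (d1.sub d2).add d3 using 1
      simp
      ring
    rw [integral_eq_sub_of_hasDerivAt hder
      (Continuous.intervalIntegrable (by fun_prop) _ _)]
    rw [pw y, pw' y]
    ring
  rw [integral_sub (Continuous.intervalIntegrable (by fun_prop) _ _)
    (hwc.intervalIntegrable _ _)] at h3
  have h4 := pw.intervalIntegral_add_eq y 0
  rw [zero_add, h0] at h4
  rw [h2]
  linarith

/-- Regularity of critical points: the profile of a solution of the weak Euler-Lagrange equation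
is a classical periodic solution of `η u'' = V' u - l`, with the prescribed average. -/
theorem classical_of_eulerLagrange {η : ℝ} (hη : 0 < η) {V' : ℝ → ℝ} (hV' : Continuous V') {r : ℝ}
    {f : lp (fun _ : ℕ => ℂ) 2}
    (hf : ∀ g, η * ⟪f, g⟫ + ∫ x in (0 : ℝ)..1,
      V' (r + ⟪greenCurve x, f⟫) * ⟪greenCurve x, g⟫ = 0) :
    ∃ (u u' : ℝ → ℝ) (l : ℝ), (∀ x, u x = r + ⟪greenCurve x, f⟫) ∧
      (∀ x, HasDerivAt u (u' x) x) ∧ (∀ x, HasDerivAt u' ((V' (u x) - l) / η) x) ∧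
      Function.Periodic u 1 ∧ ∫ x in (0 : ℝ)..1, u x = r ∧
      ‖f‖ ^ 2 = ∫ x in (0 : ℝ)..1, u' x ^ 2 := by
  set h : ℝ → ℝ := fun x => V' (r + ⟪greenCurve x, f⟫) with hh
  have hgc := continuous_greenCurve
  have hc : Continuous h := by
    apply hV'.comp
    fun_prop
  have hp : Function.Periodic h 1 := fun x => by simp only [hh, periodic_greenCurve x]
  set l := ∫ x in (0 : ℝ)..1, h x with hl
  obtain ⟨w', hw', pw', mw'⟩ := exists_periodic_primitive (g := fun x => h x - l)
    (by fun_prop) (fun x => by simp only [hp x])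
    (by rw [integral_sub (hc.intervalIntegrable _ _) (by simp)]; simp [hl])
  have hw'c : Continuous w' := continuous_iff_continuousAt.mpr fun x => (hw' x).continuousAt
  obtain ⟨w, hw, pw, mw⟩ := exists_periodic_primitive hw'c pw' mw'
  have hwc : Continuous w := continuous_iff_continuousAt.mpr fun x => (hw x).continuousAt
  have key : ∀ y, r + ⟪greenCurve y, f⟫ = r + w y / η := by
    intro y
    have h1 := hf (greenCurve y)
    rw [integral_mul_inner_greenCurve hc hp hw hw' pw pw' mw y, real_inner_comm] at h1
    rw [eq_comm, add_right_inj, div_eq_iff hη.ne']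
    linarith
  refine ⟨fun x => r + w x / η, fun x => w' x / η, l, fun x => (key x).symm,
    fun x => ((hw x).div_const η).const_add r, fun x => ?_, fun x => by simp only [pw x], ?_, ?_⟩
  · have := (hw' x).div_const η
    simpa only [hh, key x] using this
  · rw [integral_add (by simp) ((hwc.div_const η).intervalIntegrable _ _)]
    simp [mw]
  · have h1 := hf f
    have h2 : ∫ x in (0 : ℝ)..1, V' (r + ⟪greenCurve x, f⟫) * ⟪greenCurve x, f⟫ =
        (∫ x in (0 : ℝ)..1, h x * w x) / η := by
      rw [← intervalIntegral.integral_div]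
      congr 1
      funext x
      have := key x
      rw [add_right_inj] at this
      rw [mul_div_assoc, ← this]
    have h3 : ∫ x in (0 : ℝ)..1, (h x * w x + (w' x ^ 2 - l * w x)) = 0 := by
      have hder : ∀ x ∈ uIcc (0 : ℝ) 1, HasDerivAt (fun x => w' x * w x)
          (h x * w x + (w' x ^ 2 - l * w x)) x := by
        intro x _
        convert! (hw' x).mul (hw x) using 1
        ring
      rw [integral_eq_sub_of_hasDerivAt hder (Continuous.intervalIntegrable (by fun_prop) _ _)]
      have e1 := pw 0
      have e2 := pw' 0
      rw [zero_add] at e1 e2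
      rw [e1, e2, sub_self]
    have i1 : IntervalIntegrable (fun x => h x * w x) volume 0 1 :=
      (hc.mul hwc).intervalIntegrable _ _
    have i2 : IntervalIntegrable (fun x => w' x ^ 2) volume 0 1 :=
      (hw'c.pow 2).intervalIntegrable _ _
    have i3 : IntervalIntegrable (fun x => l * w x) volume 0 1 :=
      (hwc.const_mul l).intervalIntegrable _ _
    rw [intervalIntegral.integral_add i1 (i2.sub i3), intervalIntegral.integral_sub i2 i3,
      intervalIntegral.integral_const_mul, mw] at h3
    rw [h2, real_inner_self_eq_norm_sq] at h1
    have h4 : ∫ x in (0 : ℝ)..1, (w' x / η) ^ 2 = (∫ x in (0 : ℝ)..1, w' x ^ 2) / η ^ 2 := by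
      rw [← intervalIntegral.integral_div]
      simp only [div_pow]
    rw [h4]
    field_simp at h1 ⊢
    linarith

/-! ### Comparison profiles -/

theorem trapezoid_mem_Icc {p q : ℝ} (hq : 0 ≤ q) (hqp : q ≤ p) (x : ℝ) :
    |x - (1 / 2 - p)| - |x - (1 / 2 - q)| - |x - (1 / 2 + q)| + |x - (1 / 2 + p)| ∈
      Icc 0 (2 * (p - q)) := by
  constructor <;>
  · rcases abs_cases (x - (1 / 2 - p)) with h1 | h1 <;>
    rcases abs_cases (x - (1 / 2 - q)) with h2 | h2 <;>
    rcases abs_cases (x - (1 / 2 + q)) with h3 | h3 <;>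
    rcases abs_cases (x - (1 / 2 + p)) with h4 | h4 <;> linarith

/-- The comparison profile: a trapezoid with values `a` and `b`, average `r` and two transition
layers of small width. Since the second derivative of the Green function is a point mass up to a
constant, a combination of four of its translates is such a piecewise linear function. -/
theorem exists_trapezoid {V : ℝ → ℝ} (hV : Continuous V) {a b r : ℝ} (hr : r ∈ Ioo a b)
    (ha : V a = 0) (hb : V b = 0) {s : ℝ} (hs : 0 < s) :
    ∃ f : lp (fun _ : ℕ => ℂ) 2, (∀ x ∈ Icc (0 : ℝ) 1, r + ⟪greenCurve x, f⟫ ∈ Icc a b) ∧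
      ∫ x in (0 : ℝ)..1, V (r + ⟪greenCurve x, f⟫) ≤ s := by
  obtain ⟨hr1, hr2⟩ := hr
  have hab : 0 < b - a := by linarith
  obtain ⟨M, hM⟩ := (isCompact_Icc (a := a) (b := b)).exists_bound_of_continuousOn hV.continuousOn
  have hM0 : 0 ≤ M := (norm_nonneg _).trans (hM a ⟨le_rfl, by linarith⟩)
  -- `t` is the fraction of the period spent near `b`, and `d` the width of a transition layer.
  obtain ⟨t, ht⟩ : ∃ t, t = (r - a) / (b - a) := ⟨_, rfl⟩
  have ht0 : 0 < t := by rw [ht]; exact div_pos (by linarith) hab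
  have ht1 : t < 1 := by rw [ht, div_lt_one hab]; linarith
  have htr : t * (b - a) = r - a := by rw [ht]; field_simp
  obtain ⟨d, hd0, hd⟩ : ∃ d, 0 < d ∧ d < min (min t (1 - t)) (s / (2 * (M + 1))) :=
    exists_between (lt_min (lt_min ht0 (by linarith)) (by positivity))
  have hd1 : d < t := hd.trans_le ((min_le_left _ _).trans (min_le_left _ _))
  have hd2 : d < 1 - t := hd.trans_le ((min_le_left _ _).trans (min_le_right _ _))
  have hd3 : 2 * M * d ≤ s := by
    have := hd.trans_le (min_le_right _ _)
    rw [lt_div_iff₀ (by positivity)] at this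
    nlinarith
  obtain ⟨p, hp⟩ : ∃ p, p = (t + d) / 2 := ⟨_, rfl⟩
  obtain ⟨q, hq⟩ : ∃ q, q = (t - d) / 2 := ⟨_, rfl⟩
  set f : lp (fun _ : ℕ => ℂ) 2 := (-((b - a) / d)) • (greenCurve (1 / 2 - p)
    - greenCurve (1 / 2 - q) - greenCurve (1 / 2 + q) + greenCurve (1 / 2 + p)) with hf
  set A : ℝ → ℝ := fun x => |x - (1 / 2 - p)| - |x - (1 / 2 - q)| - |x - (1 / 2 + q)|
    + |x - (1 / 2 + p)| with hA
  have hval : ∀ x ∈ Icc (0 : ℝ) 1, r + ⟪greenCurve x, f⟫ = a + (b - a) * (A x / (2 * d)) := by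
    rintro x ⟨hx0, hx1⟩
    have hle : ∀ y : ℝ, 0 ≤ y → y ≤ 1 → |x - y| ≤ 1 := fun y h0 h1 =>
      abs_le.mpr ⟨by linarith, by linarith⟩
    rw [hf, inner_smul_right, inner_add_right, inner_sub_right, inner_sub_right,
      inner_greenCurve (hle _ (by linarith) (by linarith)),
      inner_greenCurve (hle _ (by linarith) (by linarith)),
      inner_greenCurve (hle _ (by linarith) (by linarith)),
      inner_greenCurve (hle _ (by linarith) (by linarith))]
    simp only [hA, sq_abs]
    generalize |x - (1 / 2 - p)| = A1
    generalize |x - (1 / 2 - q)| = A2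
    generalize |x - (1 / 2 + q)| = A3
    generalize |x - (1 / 2 + p)| = A4
    have hr' : r = a + t * (b - a) := by linarith
    rw [hr', hp, hq]
    field_simp
    ring
  have hA0 : ∀ x, 0 ≤ A x ∧ A x ≤ 2 * d := by
    intro x
    have h1 := trapezoid_mem_Icc (p := p) (q := q) (by linarith) (by linarith) x
    have h2 : 2 * (p - q) = 2 * d := by rw [hp, hq]; ring
    rwa [h2] at h1
  have hmem : ∀ x ∈ Icc (0 : ℝ) 1, r + ⟪greenCurve x, f⟫ ∈ Icc a b := by
    intro x hx
    rw [hval x hx]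
    have h1 : 0 ≤ A x / (2 * d) := div_nonneg (hA0 x).1 (by positivity)
    have h2 : A x / (2 * d) ≤ 1 := by rw [div_le_one (by positivity)]; exact (hA0 x).2
    constructor <;> nlinarith
  refine ⟨f, hmem, ?_⟩
  set v : ℝ → ℝ := fun x => V (r + ⟪greenCurve x, f⟫) with hv
  have hvc : Continuous v := by
    have := continuous_greenCurve
    apply hV.comp
    fun_prop
  have hbound : ∀ C x y : ℝ, x ≤ y → (∀ z ∈ Icc x y, ‖v z‖ ≤ C) →
      ∫ z in x..y, v z ≤ C * (y - x) := by
    intro C x y hxy hC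
    have h1 := norm_integral_le_of_norm_le_const (a := x) (b := y) (f := v) (C := C)
      (fun z hz => hC z (by rw [uIoc_of_le hxy] at hz; exact Ioc_subset_Icc_self hz))
    rw [abs_of_nonneg (by linarith)] at h1
    exact (le_abs_self _).trans h1
  have hzero : ∀ x ∈ Icc (0 : ℝ) 1, A x = 0 → ‖v x‖ ≤ 0 := by
    intro x hx h
    simp only [hv]
    rw [hval x hx, h]
    simp [ha]
  have hone : ∀ x ∈ Icc (0 : ℝ) 1, A x = 2 * d → ‖v x‖ ≤ 0 := by
    intro x hx h
    simp only [hv]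
    rw [hval x hx, h, div_self (by positivity)]
    simp [hb]
  have i1 := hbound 0 0 (1 / 2 - p) (by linarith) fun x hx => by
    refine hzero x ⟨hx.1, by linarith [hx.2]⟩ ?_
    simp only [hA]
    rw [abs_of_nonpos (by linarith [hx.2]), abs_of_nonpos (by linarith [hx.2]),
      abs_of_nonpos (by linarith [hx.2]), abs_of_nonpos (by linarith [hx.2])]
    ring
  have i2 := hbound M (1 / 2 - p) (1 / 2 - q) (by linarith) fun x hx =>
    hM _ (hmem x ⟨by linarith [hx.1], by linarith [hx.2]⟩)
  have i3 := hbound 0 (1 / 2 - q) (1 / 2 + q) (by linarith) fun x hx => by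
    refine hone x ⟨by linarith [hx.1], by linarith [hx.2]⟩ ?_
    simp only [hA]
    rw [abs_of_nonneg (by linarith [hx.1]), abs_of_nonneg (by linarith [hx.1]),
      abs_of_nonpos (by linarith [hx.2]), abs_of_nonpos (by linarith [hx.2])]
    linarith
  have i4 := hbound M (1 / 2 + q) (1 / 2 + p) (by linarith) fun x hx =>
    hM _ (hmem x ⟨by linarith [hx.1], by linarith [hx.2]⟩)
  have i5 := hbound 0 (1 / 2 + p) 1 (by linarith) fun x hx => by
    refine hzero x ⟨by linarith [hx.1], hx.2⟩ ?_
    simp only [hA]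
    rw [abs_of_nonneg (by linarith [hx.1]), abs_of_nonneg (by linarith [hx.1]),
      abs_of_nonneg (by linarith [hx.1]), abs_of_nonneg (by linarith [hx.1])]
    ring
  have hi : ∀ x y, IntervalIntegrable v volume x y := fun x y => hvc.intervalIntegrable x y
  rw [← integral_add_adjacent_intervals (hi 0 (1 / 2 - p)) (hi _ 1),
    ← integral_add_adjacent_intervals (hi (1 / 2 - p) (1 / 2 - q)) (hi _ 1),
    ← integral_add_adjacent_intervals (hi (1 / 2 - q) (1 / 2 + q)) (hi _ 1),
    ← integral_add_adjacent_intervals (hi (1 / 2 + q) (1 / 2 + p)) (hi _ 1)]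
  have : p - q = d := by rw [hp, hq]; ring
  nlinarith

/-! ### Double-well potentials and the maximum principle -/

/-- A nonnegative `C¹` potential `V` on the line, with derivative `V'`, that vanishes exactly at
`a < b` and whose derivative is at most `-κ` left of `α < a` and at least `κ` right of `β > b`. -/
structure IsDoubleWell (V V' : ℝ → ℝ) (α a b β κ : ℝ) : Prop where
  hasDerivAt : ∀ y, HasDerivAt V (V' y) y
  continuous_deriv : Continuous V'
  left_lt : α < a
  lt : a < b
  lt_right : b < β
  zero_left : V a = 0
  zero_right : V b = 0
  pos : ∀ y, y ≠ a → y ≠ b → 0 < V y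
  slope_pos : 0 < κ
  deriv_left : ∀ y ≤ α, V' y ≤ -κ
  deriv_right : ∀ y, β ≤ y → κ ≤ V' y

namespace IsDoubleWell

variable {V V' : ℝ → ℝ} {α a b β κ : ℝ}

theorem reflect (h : IsDoubleWell V V' α a b β κ) :
    IsDoubleWell (fun y => V (-y)) (fun y => -V' (-y)) (-β) (-b) (-a) (-α) κ where
  hasDerivAt y := by
    have := (h.hasDerivAt (-y)).comp y (hasDerivAt_neg y)
    rwa [mul_neg_one] at this
  continuous_deriv := (h.continuous_deriv.comp continuous_neg).neg
  left_lt := neg_lt_neg h.lt_right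
  lt := neg_lt_neg h.lt
  lt_right := neg_lt_neg h.left_lt
  zero_left := by simpa using h.zero_right
  zero_right := by simpa using h.zero_left
  pos y h1 h2 := h.pos _ (fun e => h2 (by rw [← e, neg_neg])) (fun e => h1 (by rw [← e, neg_neg]))
  slope_pos := h.slope_pos
  deriv_left y hy := neg_le_neg (h.deriv_right _ (by linarith))
  deriv_right y hy := by
    have := h.deriv_left (-y) (by linarith)
    linarith

theorem continuous (h : IsDoubleWell V V' α a b β κ) : Continuous V :=
  continuous_iff_continuousAt.mpr fun y => (h.hasDerivAt y).continuousAt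

theorem nonneg (h : IsDoubleWell V V' α a b β κ) (y : ℝ) : 0 ≤ V y := by
  rcases eq_or_ne y a with rfl | h1
  · exact h.zero_left.ge
  rcases eq_or_ne y b with rfl | h2
  · exact h.zero_right.ge
  exact (h.pos y h1 h2).le

theorem le_of_le_left (h : IsDoubleWell V V' α a b β κ) {y : ℝ} (hy : y ≤ α) :
    V α + κ * (α - y) ≤ V y := by
  have hanti : AntitoneOn (fun y => V y + κ * y) (Iic α) := by
    refine antitoneOn_of_hasDerivWithinAt_nonpos (f' := fun y => V' y + κ) (convex_Iic α)
      (Continuous.continuousOn (h.continuous.add (by fun_prop))) (fun y hy => ?_) (fun y hy => ?_)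
    · have := (h.hasDerivAt y).add ((hasDerivAt_id y).const_mul κ)
      rw [mul_one] at this
      exact this.hasDerivWithinAt
    · rw [interior_Iic] at hy
      have := h.deriv_left y (le_of_lt hy)
      linarith
  have h1 : V α + κ * α ≤ V y + κ * y := hanti (mem_Iic.mpr hy) (mem_Iic.mpr le_rfl) hy
  linarith

theorem left_growth (h : IsDoubleWell V V' α a b β κ) (y : ℝ) : κ * (α - y) ≤ V y := by
  rcases le_total y α with hy | hy
  · linarith [h.le_of_le_left hy, h.nonneg α]
  · nlinarith [h.nonneg y, h.slope_pos]

theorem right_growth (h : IsDoubleWell V V' α a b β κ) (y : ℝ) : κ * (y - β) ≤ V y := by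
  have := h.reflect.left_growth (-y)
  simp only [neg_neg] at this
  linarith

theorem abs_sub_le (h : IsDoubleWell V V' α a b β κ) (y : ℝ) :
    |y - a| ≤ β - α + V y / κ := by
  have h1 : α - y ≤ V y / κ := by
    rw [le_div_iff₀ h.slope_pos]
    linarith [h.left_growth y]
  have h2 : y - β ≤ V y / κ := by
    rw [le_div_iff₀ h.slope_pos]
    linarith [h.right_growth y]
  rw [abs_le]
  constructor <;> linarith [h.left_lt, h.lt, h.lt_right]

/-- Low potential forces the argument into a neighbourhood of the wells. -/
theorem exists_near_wells (h : IsDoubleWell V V' α a b β κ) {τ : ℝ} (hτ : 0 < τ) :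
    ∃ s > 0, ∀ y, V y < s → |y - a| < τ ∨ |y - b| < τ := by
  have hlt := h.left_lt.trans (h.lt.trans h.lt_right)
  have hα : 0 < V α := h.pos α h.left_lt.ne (h.left_lt.trans h.lt).ne
  have hβ : 0 < V β := h.pos β (h.lt.trans h.lt_right).ne' h.lt_right.ne'
  have hout : ∀ y, y ∉ Icc α β → min (V α) (V β) ≤ V y := by
    intro y hy
    rcases lt_or_ge y α with h1 | h1
    · exact (min_le_left _ _).trans (by nlinarith [h.le_of_le_left h1.le, h.slope_pos])
    · have h2 : β ≤ y := by
        by_contra h2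
        exact hy ⟨h1, (not_le.mp h2).le⟩
      have h3 := h.reflect.le_of_le_left (y := -y) (by linarith)
      simp only [neg_neg] at h3
      exact (min_le_right _ _).trans (by nlinarith [h.slope_pos])
  set K := Icc α β ∩ {y | τ ≤ |y - a| ∧ τ ≤ |y - b|} with hK
  have hKc : IsCompact K := by
    refine isCompact_Icc.inter_right ?_
    have h1 : Continuous fun y : ℝ => |y - a| := by fun_prop
    have h2 : Continuous fun y : ℝ => |y - b| := by fun_prop
    exact (isClosed_le continuous_const h1).inter (isClosed_le continuous_const h2)
  have hKpos : ∃ s > 0, ∀ y ∈ K, s ≤ V y := by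
    rcases K.eq_empty_or_nonempty with he | hne
    · exact ⟨1, one_pos, by simp [he]⟩
    · obtain ⟨z, hz, hmin⟩ := hKc.exists_isMinOn hne h.continuous.continuousOn
      refine ⟨V z, h.pos z ?_ ?_, fun y hy => hmin hy⟩
      · rintro rfl
        have := hz.2.1
        simp at this
        linarith
      · rintro rfl
        have := hz.2.2
        simp at this
        linarith
  obtain ⟨s, hs, hsK⟩ := hKpos
  refine ⟨min s (min (V α) (V β)), lt_min hs (lt_min hα hβ), fun y hy => ?_⟩
  by_contra hcon
  push Not at hcon
  by_cases hy2 : y ∈ Icc α β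
  · exact absurd (hsK y ⟨hy2, hcon⟩) (not_le.mpr (hy.trans_le (min_le_left _ _)))
  · exact absurd (hout y hy2) (not_le.mpr (hy.trans_le (min_le_right _ _)))

/-- A profile of low total energy whose average lies strictly between the wells takes, at some
point of low energy density, a value near the left well: otherwise `b - τ - u` would be dominated
by a multiple of the energy density, contradicting the average. -/
theorem exists_point_near_left (h : IsDoubleWell V V' α a b β κ) {r : ℝ} (hr : r ∈ Ioo a b)
    {τ s : ℝ} (hτ : 0 < τ) (hs : 0 < s) :
    ∃ E₀ > 0, ∀ u e : ℝ → ℝ, Continuous u → Continuous e → (∀ x, V (u x) ≤ e x) →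
      ∫ x in (0 : ℝ)..1, u x = r → ∫ x in (0 : ℝ)..1, e x ≤ E₀ →
      ∃ x, e x < s ∧ |u x - a| < τ := by
  obtain ⟨hr1, hr2⟩ := hr
  obtain ⟨σ, hσ0, hσ⟩ : ∃ σ, 0 < σ ∧ σ < min τ (b - r) :=
    exists_between (lt_min hτ (by linarith))
  have hστ : σ < τ := hσ.trans_le (min_le_left _ _)
  have hσr : σ < b - r := hσ.trans_le (min_le_right _ _)
  obtain ⟨s₁, hs₁, hnear⟩ := h.exists_near_wells hσ0
  set s' := min s s₁ with hs'
  have hs'0 : 0 < s' := lt_min hs hs₁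
  have hκ := h.slope_pos
  have hbα : 0 < b - σ - α := by linarith [h.left_lt]
  set M := (b - σ - α) / s' + 1 / κ with hM
  have hM0 : 0 < M := by positivity
  refine ⟨(b - σ - r) / (2 * M), div_pos (by linarith) (by positivity), ?_⟩
  intro u e hu he hVe hmean hE
  by_contra hcon
  push Not at hcon
  have hdom : ∀ x, b - σ - u x ≤ M * e x := by
    intro x
    have he0 : 0 ≤ e x := (h.nonneg _).trans (hVe x)
    rcases le_or_gt (b - σ) (u x) with h1 | h1
    · have : 0 ≤ M * e x := by positivity
      linarith
    · have h2 : s' ≤ e x := by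
        by_contra h3
        push Not at h3
        rcases hnear (u x) ((hVe x).trans_lt (h3.trans_le (min_le_right _ _))) with h4 | h4
        · exact absurd (h4.trans hστ)
            (not_lt.mpr (hcon x (h3.trans_le (min_le_left _ _))))
        · rw [abs_lt] at h4
          linarith
      have h5 : α - u x ≤ e x / κ := by
        rw [le_div_iff₀ hκ]
        linarith [h.left_growth (u x), hVe x]
      have h6 : b - σ - α ≤ (b - σ - α) / s' * e x := by
        rw [div_mul_eq_mul_div, le_div_iff₀ hs'0]
        gcongr
      have h7 : M * e x = (b - σ - α) / s' * e x + e x / κ := by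
        rw [hM]
        ring
      linarith
  have hint : ∫ x in (0 : ℝ)..1, (b - σ - u x) ≤ ∫ x in (0 : ℝ)..1, M * e x :=
    integral_mono_on zero_le_one (Continuous.intervalIntegrable (by fun_prop) _ _)
      (Continuous.intervalIntegrable (by fun_prop) _ _) fun x _ => hdom x
  rw [integral_sub (by simp) (hu.intervalIntegrable _ _), hmean,
    intervalIntegral.integral_const_mul] at hint
  simp only [intervalIntegral.integral_const, sub_zero, one_smul] at hint
  have h8 : M * ∫ x in (0 : ℝ)..1, e x ≤ M * ((b - σ - r) / (2 * M)) := by gcongr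
  have h9 : M * ((b - σ - r) / (2 * M)) = (b - σ - r) / 2 := by field_simp
  linarith

theorem exists_point_near_right (h : IsDoubleWell V V' α a b β κ) {r : ℝ} (hr : r ∈ Ioo a b)
    {τ s : ℝ} (hτ : 0 < τ) (hs : 0 < s) :
    ∃ E₀ > 0, ∀ u e : ℝ → ℝ, Continuous u → Continuous e → (∀ x, V (u x) ≤ e x) →
      ∫ x in (0 : ℝ)..1, u x = r → ∫ x in (0 : ℝ)..1, e x ≤ E₀ →
      ∃ x, e x < s ∧ |u x - b| < τ := by
  obtain ⟨E₀, hE₀, H⟩ := h.reflect.exists_point_near_left (r := -r)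
    ⟨neg_lt_neg hr.2, neg_lt_neg hr.1⟩ hτ hs
  refine ⟨E₀, hE₀, fun u e hu he hV hm hE => ?_⟩
  obtain ⟨x, hx1, hx2⟩ := H (fun x => -u x) e hu.neg he (by simpa using hV)
    (by rw [intervalIntegral.integral_neg, hm]) hE
  refine ⟨x, hx1, ?_⟩
  rwa [← abs_neg, show -(u x - b) = -u x - -b by ring]

end IsDoubleWell

theorem second_deriv_nonpos_of_isLocalMax {u u' : ℝ → ℝ} (hu : ∀ x, HasDerivAt u (u' x) x)
    {x₀ k : ℝ} (hk : HasDerivAt u' k x₀) (hmax : IsLocalMax u x₀) : k ≤ 0 := by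
  by_contra hpos
  push Not at hpos
  have hd : deriv u = u' := funext fun x => (hu x).deriv
  have hmin : IsLocalMin u x₀ := isLocalMin_of_deriv_deriv_pos
    (by rw [hd, hk.deriv]; exact hpos) (by rw [hd]; exact hmax.hasDerivAt_eq_zero (hu x₀))
    (hu x₀).continuousAt
  -- A point that is both a local maximum and a local minimum makes `u` locally constant.
  have hconst : u =ᶠ[𝓝 x₀] fun _ => u x₀ := by
    filter_upwards [hmax, hmin] with x h1 h2 using le_antisymm h1 h2
  have h1 := hconst.deriv.deriv_eq
  rw [hd, hk.deriv] at h1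
  simp at h1
  exact hpos.ne' h1

/-- Maximum principle for periodic solutions of `u'' = F u`. -/
theorem le_of_periodic_of_pos {u u' F : ℝ → ℝ} (hu : ∀ x, HasDerivAt u (u' x) x)
    (hu' : ∀ x, HasDerivAt u' (F (u x)) x) (hp : Function.Periodic u 1) {β : ℝ}
    (hF : ∀ y, β < y → 0 < F y) (x : ℝ) : u x ≤ β := by
  have huc : Continuous u := continuous_iff_continuousAt.mpr fun x => (hu x).continuousAt
  obtain ⟨z, -, hz⟩ := (isCompact_Icc (a := (0 : ℝ)) (b := 1)).exists_isMaxOn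
    (nonempty_Icc.mpr zero_le_one) huc.continuousOn
  have hmax : ∀ y, u y ≤ u z := by
    intro y
    obtain ⟨y', hy', he⟩ := hp.exists_mem_Ico₀ one_pos y
    rw [he]
    exact hz (Ico_subset_Icc_self hy')
  have hloc : IsLocalMax u z := Eventually.of_forall hmax
  have h1 := second_deriv_nonpos_of_isLocalMax hu (hu' z) hloc
  by_contra hcon
  push Not at hcon
  exact absurd (hF _ (hcon.trans_le (hmax x))) (not_lt.mpr h1)

theorem ge_of_periodic_of_neg {u u' F : ℝ → ℝ} (hu : ∀ x, HasDerivAt u (u' x) x)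
    (hu' : ∀ x, HasDerivAt u' (F (u x)) x) (hp : Function.Periodic u 1) {α : ℝ}
    (hF : ∀ y, y < α → F y < 0) (x : ℝ) : α ≤ u x := by
  have := le_of_periodic_of_pos (u := fun x => -u x) (F := fun y => -F (-y))
    (fun x => (hu x).neg) (fun x => by simpa only [neg_neg] using! (hu' x).neg)
    (fun x => by simp only [hp x])
    (β := -α) (fun y hy => by linarith [hF (-y) (by linarith)]) x
  linarith

/-! ### Periodic solutions for small capillarity -/

/-- Minimizers have small energy, uniformly for small perturbations `t g` of the potential `V` and
small `η`. The energy is measured with the unperturbed potential. -/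
theorem IsDoubleWell.exists_low_energy_solution {V V' : ℝ → ℝ} {α a b β κ : ℝ}
    (h : IsDoubleWell V V' α a b β κ) {g g' : ℝ → ℝ} {G : ℝ} (hg : ∀ y, HasDerivAt g (g' y) y)
    (hg'c : Continuous g') (hgG : ∀ y, |g y| ≤ G * |y - a|) (hG : 0 < G)
    {r : ℝ} (hr : r ∈ Ioo a b) {E : ℝ} (hE : 0 < E) :
    ∃ t₀ > 0, ∃ ε₀ > 0, ∀ t, 0 ≤ t → t ≤ t₀ → ∀ η, 0 < η → η < ε₀ →
      ∃ (u u' : ℝ → ℝ) (l : ℝ), (∀ x, HasDerivAt u (u' x) x) ∧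
        (∀ x, HasDerivAt u' ((V' (u x) + t * g' (u x) - l) / η) x) ∧
        Function.Periodic u 1 ∧ ∫ x in (0 : ℝ)..1, u x = r ∧
        ∫ x in (0 : ℝ)..1, (η / 2 * u' x ^ 2 + V (u x)) ≤ E := by
  have hκ := h.slope_pos
  have hVc := h.continuous
  have hgc : Continuous g := continuous_iff_continuousAt.mpr fun y => (hg y).continuousAt
  have hkc := continuous_greenCurve
  obtain ⟨f₀, hf₀m, hf₀⟩ := exists_trapezoid hVc hr h.zero_left h.zero_right
    (show 0 < E / 8 by positivity)
  set D := β - α with hD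
  have hD0 : 0 < D := by linarith [h.left_lt, h.lt, h.lt_right]
  have hDab : b - a ≤ D := by linarith [h.left_lt, h.lt, h.lt_right]
  have hgV : ∀ y, |g y| ≤ G * (D + V y / κ) := fun y =>
    (hgG y).trans (by gcongr; exact h.abs_sub_le y)
  -- The first bound on `t` lets half of `V` absorb the linear growth of `t g`; the other bounds make
  -- the remaining errors, and the gradient term of the trapezoid, at most `E / 8` each.
  refine ⟨min (κ / (2 * G)) (E / (8 * G * D)), by positivity, E / (4 * (‖f₀‖ ^ 2 + 1)),
    by positivity, ?_⟩
  intro t ht0 ht η hη hηε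
  have ht1 : t * G / κ ≤ 1 / 2 := by
    have := ht.trans (min_le_left _ _)
    rw [le_div_iff₀ (by positivity)] at this
    rw [div_le_iff₀ hκ]
    linarith
  have ht2 : t * (G * D) ≤ E / 8 := by
    have := ht.trans (min_le_right _ _)
    rw [le_div_iff₀ (by positivity)] at this
    linarith
  have hη2 : η / 2 * ‖f₀‖ ^ 2 ≤ E / 8 := by
    rw [lt_div_iff₀ (by positivity)] at hηε
    linarith
  have htg : ∀ y, |t * g y| ≤ E / 8 + V y / 2 := by
    intro y
    rw [abs_mul, abs_of_nonneg ht0]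
    have h1 : t * |g y| ≤ t * (G * (D + V y / κ)) := by gcongr; exact hgV y
    have h2 : t * (G * (D + V y / κ)) = t * (G * D) + t * G / κ * V y := by ring
    have h3 : t * G / κ * V y ≤ 1 / 2 * V y := by gcongr; exact h.nonneg y
    linarith
  have hW : ∀ y, HasDerivAt (fun y => V y + t * g y) (V' y + t * g' y) y := fun y =>
    (h.hasDerivAt y).add ((hg y).const_mul t)
  have hW'c : Continuous fun y => V' y + t * g' y := by
    have := h.continuous_deriv
    fun_prop
  obtain ⟨f, hf⟩ := exists_minimizer_profileEnergy greenCurve hkc hη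
    (V := fun y => V y + t * g y) (by fun_prop) (B := E / 8)
    (fun y => by linarith [(abs_le.mp (htg y)).1, h.nonneg y]) r
  obtain ⟨u, u', l, hu, hud, hu'd, hup, hum, hfu⟩ := classical_of_eulerLagrange hη hW'c
    (eulerLagrange_profileEnergy greenCurve hkc hW hW'c hf)
  refine ⟨u, u', l, hud, hu'd, hup, hum, ?_⟩
  have huc : Continuous u := continuous_iff_continuousAt.mpr fun x => (hud x).continuousAt
  have hu'c : Continuous u' := continuous_iff_continuousAt.mpr fun x => (hu'd x).continuousAt
  have hmin := hf f₀
  simp only [profileEnergy, ← hu] at hmin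
  set v : ℝ → ℝ := fun x => r + ⟪greenCurve x, f₀⟫ with hv
  have hvc : Continuous v := by fun_prop
  have hright : ∫ x in (0 : ℝ)..1, (V (v x) + t * g (v x)) ≤ E / 8 + E / 8 := by
    have h1 : ∫ x in (0 : ℝ)..1, (V (v x) + t * g (v x)) ≤
        ∫ x in (0 : ℝ)..1, (V (v x) + E / 8) := by
      refine integral_mono_on zero_le_one (Continuous.intervalIntegrable (by fun_prop) _ _)
        (Continuous.intervalIntegrable (by fun_prop) _ _) fun x hx => ?_
      have h2 := hf₀m x hx
      have h3 : t * g (v x) ≤ t * (G * D) := by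
        gcongr
        refine (le_abs_self _).trans ((hgG _).trans ?_)
        gcongr
        rw [abs_of_nonneg (by linarith [h2.1])]
        linarith [h2.2]
      linarith
    have i1 : IntervalIntegrable (fun x => V (v x)) volume 0 1 :=
      (hVc.comp hvc).intervalIntegrable _ _
    rw [intervalIntegral.integral_add i1 (continuous_const.intervalIntegrable _ _),
      intervalIntegral.integral_const, sub_zero, one_smul] at h1
    linarith
  have hleft : (∫ x in (0 : ℝ)..1, V (u x)) / 2 - E / 8 ≤
      ∫ x in (0 : ℝ)..1, (V (u x) + t * g (u x)) := by
    have h1 : ∫ x in (0 : ℝ)..1, (V (u x) / 2 - E / 8) ≤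
        ∫ x in (0 : ℝ)..1, (V (u x) + t * g (u x)) := by
      refine integral_mono_on zero_le_one (Continuous.intervalIntegrable (by fun_prop) _ _)
        (Continuous.intervalIntegrable (by fun_prop) _ _) fun x hx => ?_
      linarith [(abs_le.mp (htg (u x))).1]
    rw [intervalIntegral.integral_sub (Continuous.intervalIntegrable (by fun_prop) _ _)
      (by simp), intervalIntegral.integral_div] at h1
    simpa only [intervalIntegral.integral_const, sub_zero, one_smul] using h1
  rw [intervalIntegral.integral_add (Continuous.intervalIntegrable (by fun_prop) _ _)
    (Continuous.intervalIntegrable (by fun_prop) _ _), intervalIntegral.integral_const_mul, ← hfu]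
  have : 0 ≤ η / 2 * ‖f‖ ^ 2 := by positivity
  linarith

/-- The Lagrange multiplier of a low-energy solution is small: the first integral
`η/2 u'² - V u - t g u + l u` takes nearly the values `l a` and `l b` at points near the wells.
By the maximum principle the profile then stays between `α` and `β`. -/
theorem IsDoubleWell.exists_periodic_solution {V V' : ℝ → ℝ} {α a b β κ : ℝ}
    (h : IsDoubleWell V V' α a b β κ) {g g' : ℝ → ℝ} {G : ℝ} (hg : ∀ y, HasDerivAt g (g' y) y)
    (hg'c : Continuous g') (hg'G : ∀ y, |g' y| ≤ G) (hga : g a = 0) (hG : 0 < G)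
    {r : ℝ} (hr : r ∈ Ioo a b) :
    ∃ t₀ > 0, ∃ ε₀ > 0, ∀ t, 0 ≤ t → t ≤ t₀ → ∀ η, 0 < η → η < ε₀ →
      ∃ (u u' : ℝ → ℝ) (l : ℝ), (∀ x, HasDerivAt u (u' x) x) ∧
        (∀ x, HasDerivAt u' ((V' (u x) + t * g' (u x) - l) / η) x) ∧
        Function.Periodic u 1 ∧ ∫ x in (0 : ℝ)..1, u x = r ∧
        (∀ x, u x ∈ Icc α β) ∧ ∃ x y, u x ≠ u y := by
  have hκ := h.slope_pos
  have hgG : ∀ y, |g y| ≤ G * |y - a| := by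
    intro y
    have := Convex.norm_image_sub_le_of_norm_hasDerivWithin_le (f := g) (f' := g') (C := G)
      (s := univ) (x := a) (y := y) (fun x _ => (hg x).hasDerivWithinAt) (fun x _ => hg'G x)
      convex_univ trivial trivial
    rwa [hga, sub_zero] at this
  have hab : 0 < b - a := sub_pos.mpr h.lt
  have hτ : 0 < (b - a) / 4 := by positivity
  have hs : 0 < κ * (b - a) / 16 := by positivity
  obtain ⟨E₁, hE₁, H₁⟩ := h.exists_point_near_left hr hτ hs
  obtain ⟨E₂, hE₂, H₂⟩ := h.exists_point_near_right hr hτ hs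
  obtain ⟨t₀, ht₀, ε₀, hε₀, H⟩ := h.exists_low_energy_solution hg hg'c hgG hG hr
    (lt_min hE₁ hE₂)
  refine ⟨min t₀ (κ / (16 * G)), lt_min ht₀ (by positivity), ε₀, hε₀, ?_⟩
  intro t ht0 ht η hη hηε
  have htG : t * G ≤ κ / 16 := by
    have := ht.trans (min_le_right _ _)
    rw [le_div_iff₀ (by positivity)] at this
    linarith
  obtain ⟨u, u', l, hu, hu', hup, hum, hE⟩ := H t ht0 (ht.trans (min_le_left _ _)) η hη hηε
  have huc : Continuous u := continuous_iff_continuousAt.mpr fun x => (hu x).continuousAt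
  have hu'c : Continuous u' := continuous_iff_continuousAt.mpr fun x => (hu' x).continuousAt
  have hVc := h.continuous
  have hec : Continuous fun x => η / 2 * u' x ^ 2 + V (u x) := by fun_prop
  have hVe : ∀ x, V (u x) ≤ η / 2 * u' x ^ 2 + V (u x) := fun x => by
    have : 0 ≤ η / 2 * u' x ^ 2 := by positivity
    linarith
  obtain ⟨x₁, hx₁, hx₁a⟩ := H₁ u _ huc hec hVe hum (hE.trans (min_le_left _ _))
  obtain ⟨x₂, hx₂, hx₂b⟩ := H₂ u _ huc hec hVe hum (hE.trans (min_le_right _ _))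
  have hfirst : η / 2 * u' x₁ ^ 2 - V (u x₁) - t * g (u x₁) + l * u x₁ =
      η / 2 * u' x₂ ^ 2 - V (u x₂) - t * g (u x₂) + l * u x₂ := by
    have hd : ∀ x, HasDerivAt
        (fun x => η / 2 * u' x ^ 2 - V (u x) - t * g (u x) + l * u x) 0 x := by
      intro x
      have d1 := ((hu' x).pow 2).const_mul (η / 2)
      have d2 := (h.hasDerivAt (u x)).comp x (hu x)
      have d3 := ((hg (u x)).comp x (hu x)).const_mul t
      convert! ((d1.sub d2).sub d3).add ((hu x).const_mul l) using 1
      simp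
      field_simp
      ring
    exact is_const_of_deriv_eq_zero (fun x => (hd x).differentiableAt)
      (fun x => (hd x).deriv) x₁ x₂
  have n1 : 0 ≤ η / 2 * u' x₁ ^ 2 := by positivity
  have n2 : 0 ≤ η / 2 * u' x₂ ^ 2 := by positivity
  have n3 := h.nonneg (u x₁)
  have n4 := h.nonneg (u x₂)
  have hgb : ∀ y, |y - a| ≤ 2 * (b - a) → |t * g y| ≤ κ / 16 * (2 * (b - a)) := by
    intro y hy
    rw [abs_mul, abs_of_nonneg ht0]
    calc t * |g y| ≤ t * (G * |y - a|) := by gcongr; exact hgG y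
      _ = t * G * |y - a| := by ring
      _ ≤ κ / 16 * (2 * (b - a)) := by gcongr
  rw [abs_lt] at hx₁a hx₂b
  have g1 := abs_le.mp (hgb (u x₁) (abs_le.mpr ⟨by linarith, by linarith⟩))
  have g2 := abs_le.mp (hgb (u x₂) (abs_le.mpr ⟨by linarith, by linarith⟩))
  have hgap : (b - a) / 2 ≤ u x₂ - u x₁ := by linarith
  have hmul : |l * (u x₂ - u x₁)| < 3 / 8 * κ * (b - a) := by
    rw [abs_lt]
    constructor <;> nlinarith
  have hl : |l| < 3 / 4 * κ := by
    rw [abs_mul, abs_of_nonneg (a := u x₂ - u x₁) (by linarith)] at hmul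
    have : |l| * ((b - a) / 2) ≤ |l| * (u x₂ - u x₁) := by gcongr
    by_contra hcon
    push Not at hcon
    have : 3 / 4 * κ * ((b - a) / 2) ≤ |l| * ((b - a) / 2) := by gcongr
    linarith
  rw [abs_lt] at hl
  have htg' : ∀ y, |t * g' y| ≤ κ / 16 := fun y => by
    rw [abs_mul, abs_of_nonneg ht0]
    exact (mul_le_mul_of_nonneg_left (hg'G y) ht0).trans htG
  refine ⟨u, u', l, hu, hu', hup, hum, fun x => ⟨?_, ?_⟩, x₂, x₁, fun e => by linarith⟩
  · refine ge_of_periodic_of_neg (F := fun y => (V' y + t * g' y - l) / η) hu hu' hup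
      (fun y hy => div_neg_of_neg_of_pos ?_ hη) x
    linarith [h.deriv_left y hy.le, (abs_le.mp (htg' y)).2]
  · refine le_of_periodic_of_pos (F := fun y => (V' y + t * g' y - l) / η) hu hu' hup
      (fun y hy => div_pos ?_ hη) x
    linarith [h.deriv_right y hy.le, (abs_le.mp (htg' y)).1]

/-! ### From the bitangent to traveling waves -/

theorem hasDerivAt_primitive {φ : ℝ → ℝ} (hφ : Continuous φ) (a y : ℝ) :
    HasDerivAt (fun y => ∫ x in a..y, φ x) (φ y) y :=
  integral_hasDerivAt_right (hφ.intervalIntegrable _ _)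
    (hφ.stronglyMeasurableAtFilter _ _) hφ.continuousAt

theorem hasDerivAt_modifiedEnergy {Ψ : ℝ → ℝ} (hΨ : ContDiffOn ℝ 2 Ψ (Ioi 0)) (m : ℝ) {y : ℝ}
    (hy : 0 < y) :
    HasDerivAt (modifiedEnergy Ψ m) (deriv Ψ y + m ^ 2 / (2 * y ^ 2)) y := by
  have h1 : HasDerivAt Ψ (deriv Ψ y) y :=
    ((hΨ.contDiffAt (Ioi_mem_nhds hy)).differentiableAt (by norm_num)).hasDerivAt
  have h2 := ((hasDerivAt_id y).const_mul 2).inv (by simpa using hy.ne')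
  have h3 := h1.sub (h2.const_mul (m ^ 2))
  convert! h3 using 1
  simp
  field_simp
  ring

theorem contDiffOn_deriv_energy {Ψ : ℝ → ℝ} (hΨ : ContDiffOn ℝ 2 Ψ (Ioi 0)) :
    ContDiffOn ℝ 1 (deriv Ψ) (Ioi 0) :=
  hΨ.deriv_of_isOpen isOpen_Ioi (by norm_num)

/-- Below the left end point of the bitangent there is a point at which the graph approaches the
line, and above the right end point one at which it departs from it. Freezing the derivative
outside these two points turns the distance to the line into a double well. -/
theorem HasBitangent.exists_isDoubleWell {Ψ : ℝ → ℝ} (hΨ : ContDiffOn ℝ 2 Ψ (Ioi 0)) {m a b : ℝ}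
    (h : HasBitangent (modifiedEnergy Ψ m) a b) :
    ∃ (V V' : ℝ → ℝ) (α β κ l : ℝ), 0 < α ∧ IsDoubleWell V V' α a b β κ ∧
      ∀ y ∈ Icc α β, V' y = deriv Ψ y + m ^ 2 / (2 * y ^ 2) - l := by
  obtain ⟨ha, hab, hd, hv, δ, hδ, habove⟩ := h
  set Φ := modifiedEnergy Ψ m with hΦ
  set l := deriv Φ a with hl
  set w : ℝ → ℝ := fun y => deriv Ψ y + m ^ 2 / (2 * y ^ 2) - l with hw
  set W : ℝ → ℝ := fun y => Φ y - (Φ a + l * (y - a)) with hW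
  have hWd : ∀ y, 0 < y → HasDerivAt W (w y) y := by
    intro y hy
    have h1 := (((hasDerivAt_id y).sub_const a).const_mul l).const_add (Φ a)
    rw [mul_one] at h1
    exact (hasDerivAt_modifiedEnergy hΨ m hy).sub h1
  have hwc : ContinuousOn w (Ioi 0) := by
    refine ((contDiffOn_deriv_energy hΨ).continuousOn.add ?_).sub continuousOn_const
    refine continuousOn_const.div (by fun_prop) fun y hy => ?_
    have : (0 : ℝ) < y := hy
    positivity
  have hWa : W a = 0 := by simp [hW]
  have hWb : W b = 0 := by simp only [hW, hv]; ring
  have hWpos : ∀ y, 0 < y → a - δ < y → y < b + δ → y ≠ a → y ≠ b → 0 < W y :=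
    fun y h0 h1 h2 h3 h4 => sub_pos.mpr (habove y h0 h1 h2 h3 h4)
  obtain ⟨c, hc1, hca⟩ : ∃ c, max 0 (a - δ) < c ∧ c < a :=
    exists_between (max_lt ha (by linarith))
  have hc0 : 0 < c := (le_max_left _ _).trans_lt hc1
  have hcδ : a - δ < c := (le_max_right _ _).trans_lt hc1
  have hWcont : ContinuousOn W (Ioi 0) := fun y hy => (hWd y hy).continuousAt.continuousWithinAt
  obtain ⟨α, hα, hαe⟩ := exists_hasDerivAt_eq_slope W w hca
    (hWcont.mono fun y hy => hc0.trans_le hy.1) fun y hy => hWd y (hc0.trans hy.1)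
  obtain ⟨d, hbd, hdδ⟩ : ∃ d, b < d ∧ d < b + δ := exists_between (by linarith)
  obtain ⟨β, hβ, hβe⟩ := exists_hasDerivAt_eq_slope W w hbd
    (hWcont.mono fun y hy => (ha.trans hab).trans_le hy.1)
    fun y hy => hWd y ((ha.trans hab).trans hy.1)
  have hα0 : 0 < α := hc0.trans hα.1
  have hαβ : α ≤ β := by linarith [hα.2, hβ.1]
  have hwα : w α < 0 := by
    rw [hαe, hWa]
    have := hWpos c hc0 hcδ (by linarith) hca.ne (hca.trans hab).ne
    exact div_neg_of_neg_of_pos (by linarith) (by linarith)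
  have hwβ : 0 < w β := by
    rw [hβe, hWb]
    have := hWpos d (by linarith) (by linarith) hdδ (hab.trans hbd).ne' hbd.ne'
    exact div_pos (by linarith) (by linarith)
  set V' : ℝ → ℝ := fun y => w (max α (min β y)) with hV'
  have hclamp : ∀ y ∈ Icc α β, V' y = w y := fun y hy => by
    simp only [hV', min_eq_right hy.2, max_eq_right hy.1]
  have hleft : ∀ y ≤ α, V' y = w α := fun y hy => by
    simp only [hV', min_eq_right (hy.trans hαβ), max_eq_left hy]
  have hright : ∀ y, β ≤ y → V' y = w β := fun y hy => by
    simp only [hV', min_eq_left hy, max_eq_right hαβ]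
  have hV'c : Continuous V' := hwc.comp_continuous (by fun_prop)
    fun y => hα0.trans_le (le_max_left _ _)
  have hint : ∀ x y, IntervalIntegrable V' volume x y := fun x y => hV'c.intervalIntegrable _ _
  set V : ℝ → ℝ := fun y => ∫ x in a..y, V' x with hV
  have haI : a ∈ Icc α β := ⟨hα.2.le, by linarith [hβ.1]⟩
  have hVW : ∀ y ∈ Icc α β, V y = W y := by
    intro y hy
    have h1 : ∀ x ∈ uIcc a y, HasDerivAt W (V' x) x := by
      intro x hx
      have hx' := uIcc_subset_Icc haI hy hx
      rw [hclamp x hx']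
      exact hWd x (hα0.trans_le hx'.1)
    have h2 := integral_eq_sub_of_hasDerivAt h1 (hint _ _)
    rw [hWa, sub_zero] at h2
    exact h2
  have hnear : ∀ y ∈ Icc α β, y ≠ a → y ≠ b → 0 < V y := fun y hy h1 h2 => by
    rw [hVW y hy]
    exact hWpos y (hα0.trans_le hy.1) (by linarith [hα.1, hy.1]) (by linarith [hβ.2, hy.2]) h1 h2
  refine ⟨V, V', α, β, min (-w α) (w β), l, hα0, ?_, hclamp⟩
  exact
    { hasDerivAt := hasDerivAt_primitive hV'c a
      continuous_deriv := hV'c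
      left_lt := hα.2
      lt := hab
      lt_right := hβ.1
      zero_left := by rw [hVW a haI, hWa]
      zero_right := by rw [hVW b ⟨by linarith [hα.2], hβ.1.le⟩, hWb]
      pos := by
        intro y h1 h2
        rcases lt_or_ge y α with h3 | h3
        · have e1 : V y = V α + ∫ x in α..y, V' x :=
            (integral_add_adjacent_intervals (hint _ _) (hint _ _)).symm
          have e2 : ∫ x in α..y, V' x = (y - α) * w α := by
            rw [integral_congr (g := fun _ => w α)]
            · simp
            · intro x hx
              rw [uIcc_of_ge h3.le] at hx
              exact hleft x hx.2
          have e3 := hnear α ⟨le_rfl, hαβ⟩ hα.2.ne (hα.2.trans hab).ne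
          rw [e1, e2]
          nlinarith
        rcases lt_or_ge β y with h4 | h4
        · have e1 : V y = V β + ∫ x in β..y, V' x :=
            (integral_add_adjacent_intervals (hint _ _) (hint _ _)).symm
          have e2 : ∫ x in β..y, V' x = (y - β) * w β := by
            rw [integral_congr (g := fun _ => w β)]
            · simp
            · intro x hx
              rw [uIcc_of_le h4.le] at hx
              exact hright x hx.1
          have e3 := hnear β ⟨hαβ, le_rfl⟩ (hab.trans hβ.1).ne' hβ.1.ne'
          rw [e1, e2]
          nlinarith
        · exact hnear y ⟨h3, h4⟩ h1 h2
      slope_pos := lt_min (by linarith) hwβ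
      deriv_left := fun y hy => by
        rw [hleft y hy]
        linarith [min_le_left (-w α) (w β)]
      deriv_right := fun y hy => by
        rw [hright y hy]
        exact min_le_right _ _ }

/-- Periodic profiles of unit period. For `m = 0` the flux `j` is a small nonzero number, whose
contribution `-j² / (2 r)` to the energy is treated as a perturbation of the double well. -/
theorem HasBitangent.exists_profile {Ψ : ℝ → ℝ} (hΨ : ContDiffOn ℝ 2 Ψ (Ioi 0)) {m a b : ℝ}
    (h : HasBitangent (modifiedEnergy Ψ m) a b) {r : ℝ} (hr : r ∈ Ioo a b) :
    ∃ j : ℝ, j ≠ 0 ∧ (m ≠ 0 → j = m) ∧ ∃ ε₀ > 0, ∀ η, 0 < η → η < ε₀ →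
      ∃ (u u' : ℝ → ℝ) (l : ℝ), (∀ x, HasDerivAt u (u' x) x) ∧
        (∀ x, HasDerivAt u' ((deriv Ψ (u x) + j ^ 2 / (2 * u x ^ 2) - l) / η) x) ∧
        Function.Periodic u 1 ∧ ∫ x in (0 : ℝ)..1, u x = r ∧
        (∀ x, 0 < u x) ∧ ∃ x y, u x ≠ u y := by
  obtain ⟨V, V', α, β, κ, l₀, hα, hW, hV'⟩ := h.exists_isDoubleWell hΨ
  have hαβ : α ≤ β := by linarith [hW.left_lt, hW.lt, hW.lt_right]
  set g' : ℝ → ℝ := fun y => 1 / (2 * (max α (min β y)) ^ 2) with hg'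
  have hmax : ∀ y, α ≤ max α (min β y) := fun y => le_max_left _ _
  have hg'c : Continuous g' := by
    refine continuous_const.div (by fun_prop) fun y => ?_
    have : 0 < max α (min β y) := hα.trans_le (hmax y)
    positivity
  have hg'G : ∀ y, |g' y| ≤ 1 / (2 * α ^ 2) := by
    intro y
    have : 0 < max α (min β y) := hα.trans_le (hmax y)
    rw [abs_of_nonneg (by positivity)]
    simp only [hg']
    gcongr
    exact hmax y
  obtain ⟨t₀, ht₀, ε₀, hε₀, H⟩ := hW.exists_periodic_solution (hasDerivAt_primitive hg'c a)
    hg'c hg'G (by simp) (by positivity) hr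
  -- No perturbation is needed unless `m = 0`.
  obtain ⟨t, j, ht0, ht, hj0, hjm, hjt⟩ : ∃ t j : ℝ, 0 ≤ t ∧ t ≤ t₀ ∧ j ≠ 0 ∧
      (m ≠ 0 → j = m) ∧ j ^ 2 = m ^ 2 + t := by
    rcases eq_or_ne m 0 with rfl | hm
    · exact ⟨t₀, Real.sqrt t₀, ht₀.le, le_rfl, (Real.sqrt_pos.mpr ht₀).ne', fun h => absurd rfl h,
        by rw [Real.sq_sqrt ht₀.le]; ring⟩
    · exact ⟨0, m, le_rfl, ht₀.le, hm, fun _ => rfl, by ring⟩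
  refine ⟨j, hj0, hjm, ε₀, hε₀, fun η hη hηε => ?_⟩
  obtain ⟨u, u', l, hu, hu', hp, hm, hI, hne⟩ := H t ht0 ht η hη hηε
  refine ⟨u, u', l + l₀, hu, fun x => ?_, hp, hm, fun x => hα.trans_le (hI x).1, hne⟩
  convert! hu' x using 2
  have h1 : g' (u x) = 1 / (2 * u x ^ 2) := by
    simp only [hg', min_eq_right (hI x).2, max_eq_right (hI x).1]
  rw [hV' _ (hI x), h1, hjt]
  ring

section Wave

variable {Ψ R R' : ℝ → ℝ} {ε j l : ℝ}

theorem contDiff_profile (hΨ : ContDiffOn ℝ 2 Ψ (Ioi 0)) (hR : ∀ x, HasDerivAt R (R' x) x)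
    (hR' : ∀ x, HasDerivAt R' ((deriv Ψ (R x) + j ^ 2 / (2 * R x ^ 2) - l) / ε) x)
    (hpos : ∀ x, 0 < R x) : ContDiff ℝ 3 R := by
  have hd : deriv R = R' := funext fun x => (hR x).deriv
  have hd' : deriv R' = fun x => (deriv Ψ (R x) + j ^ 2 / (2 * R x ^ 2) - l) / ε :=
    funext fun x => (hR' x).deriv
  have h1 : ContDiff ℝ 1 R := by
    rw [contDiff_one_iff_deriv, hd]
    exact ⟨fun x => (hR x).differentiableAt,
      continuous_iff_continuousAt.mpr fun x => (hR' x).continuousAt⟩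
  have h2 : ContDiff ℝ 1 (deriv R') := by
    rw [hd']
    have e1 : ContDiff ℝ 1 fun x => deriv Ψ (R x) :=
      (contDiffOn_deriv_energy hΨ).comp_contDiff h1 hpos
    have e2 : ContDiff ℝ 1 fun x => j ^ 2 / (2 * R x ^ 2) :=
      contDiff_const.div (contDiff_const.mul (h1.pow 2)) fun x => by
        have := hpos x
        positivity
    exact ((e1.add e2).sub contDiff_const).div_const ε
  have h3 : ContDiff ℝ 2 R' := by
    rw [show (2 : WithTop ℕ∞) = 1 + 1 by norm_num, contDiff_succ_iff_deriv]
    exact ⟨fun x => (hR' x).differentiableAt, by simp, h2⟩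
  rw [show (3 : WithTop ℕ∞) = 2 + 1 by norm_num, contDiff_succ_iff_deriv, hd]
  exact ⟨fun x => (hR x).differentiableAt, by simp, h3⟩

/-- A positive solution of the profile equation `ε R'' = Ψ'(R) + j² / (2 R²) - l` gives, for every
speed `c`, a traveling wave with mass flux `j`. -/
theorem isSolution_of_profile (hΨ : ContDiffOn ℝ 2 Ψ (Ioi 0)) (hε : ε ≠ 0)
    (hR : ∀ x, HasDerivAt R (R' x) x)
    (hR' : ∀ x, HasDerivAt R' ((deriv Ψ (R x) + j ^ 2 / (2 * R x ^ 2) - l) / ε) x)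
    (hpos : ∀ x, 0 < R x) (c : ℝ) :
    IsSolution Ψ ε (fun x t => R (x - c * t)) (fun x t => c * R (x - c * t) + j) := by
  have hcd := contDiff_profile hΨ hR hR' hpos
  have hx : ∀ x t, HasDerivAt (fun y => R (y - c * t)) (R' (x - c * t)) x := fun x t => by
    have := (hR (x - c * t)).comp x ((hasDerivAt_id x).sub_const (c * t))
    rwa [mul_one] at this
  have ht : ∀ x t, HasDerivAt (fun s => R (x - c * s)) (-c * R' (x - c * t)) t := fun x t => by
    have := (hR (x - c * t)).comp t (((hasDerivAt_id t).const_mul c).const_sub x)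
    rwa [mul_one, mul_comm] at this
  have hsm : ContDiff ℝ 3 fun z : ℝ × ℝ => R (z.1 - c * z.2) := by
    apply hcd.comp
    fun_prop
  refine ⟨fun x t _ => hpos _, hsm.contDiffOn, ?_, fun x t _ => ?_, fun x t _ => ?_⟩
  · exact ((contDiff_const.mul (hsm.of_le (by norm_num))).add contDiff_const).contDiffOn
  · rw [(ht x t).deriv, (((hx x t).const_mul c).add_const j).deriv]
    ring
  · have hp := hpos (x - c * t)
    have hΨ1 : ∀ y, 0 < y → HasDerivAt Ψ (deriv Ψ y) y := fun y hy =>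
      ((hΨ.contDiffAt (Ioi_mem_nhds hy)).differentiableAt (by norm_num)).hasDerivAt
    have hΨ2 : ∀ y, 0 < y → HasDerivAt (deriv Ψ) (deriv (deriv Ψ) y) y := fun y hy =>
      (((contDiffOn_deriv_energy hΨ).contDiffAt (Ioi_mem_nhds hy)).differentiableAt
        (by norm_num)).hasDerivAt
    have d1 := ((ht x t).const_mul c).add_const j
    have d2 := ((((hx x t).const_mul c).add_const j).pow 2).div (hx x t) hp.ne'
    have d3 := ((hx x t).mul ((hΨ2 _ hp).comp x (hx x t))).sub ((hΨ1 _ hp).comp x (hx x t))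
    have d4 : HasDerivAt
        (fun y => ε * iteratedDeriv 2 (fun z => (fun x t => R (x - c * t)) z t) y)
        (deriv (deriv Ψ) (R (x - c * t)) * R' (x - c * t)
          - j ^ 2 / R (x - c * t) ^ 3 * R' (x - c * t)) x := by
      have e1 : deriv (fun z => R (z - c * t)) = fun z => R' (z - c * t) :=
        funext fun z => (hx z t).deriv
      have e2 : (fun y => ε * iteratedDeriv 2 (fun z => R (z - c * t)) y) =
          fun y => deriv Ψ (R (y - c * t)) + j ^ 2 * (2 * R (y - c * t) ^ 2)⁻¹ - l := by
        funext y
        have e3 := (hR' (y - c * t)).comp y ((hasDerivAt_id y).sub_const (c * t))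
        rw [mul_one] at e3
        rw [iteratedDeriv_succ, iteratedDeriv_one, e1]
        refine (congrArg (ε * ·) e3.deriv).trans ?_
        field_simp
      rw [e2]
      have e4 := (((hx x t).pow 2).const_mul 2).inv (by simp; exact hp.ne')
      convert! (((hΨ2 _ hp).comp x (hx x t)).add (e4.const_mul (j ^ 2))).sub_const l using 1
      simp
      field_simp
      ring
    have e5 : deriv (fun y => pressure Ψ (R (y - c * t))) x = _ := d3.deriv
    have e6 : deriv (fun y => (c * R (y - c * t) + j) ^ 2 / R (y - c * t)) x = _ := d2.deriv
    rw [d1.deriv, d4.deriv, e5, e6]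
    simp
    field_simp
    ring

end Wave

end EulerKorteweg

theorem corollary3p4 (Ψ : ℝ → ℝ) (hΨ : ContDiffOn ℝ 2 Ψ (Set.Ioi 0))
    (m ρg ρl : ℝ)
    (hbit : EulerKorteweg.HasBitangent (EulerKorteweg.modifiedEnergy Ψ m) ρg ρl)
    (ρs : ℝ) (hρs : ρs ∈ Set.Ioo ρg ρl) :
    ∃ ε₀ : ℝ, 0 < ε₀ ∧
      ∀ ε : ℝ, 0 < ε → ∀ ω : ℝ, 0 < ω → ε / ω ^ 2 < ε₀ → ∀ c : ℝ,
        ∃ ρ q : ℝ → ℝ → ℝ,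
          EulerKorteweg.IsSolution Ψ ε ρ q ∧
          EulerKorteweg.IsTravelingWave c ρ q ∧
          EulerKorteweg.IsSpacePeriodic ω ρ q ∧
          (∀ t : ℝ, 0 < t → (1 / ω) * (∫ x in (0 : ℝ)..ω, ρ x t) = ρs) ∧
          EulerKorteweg.HasPhaseTransition c ρ q ∧
          EulerKorteweg.NonConstantInSpace ρ ∧
          EulerKorteweg.NonConstantInSpace (fun x t => q x t / ρ x t) ∧
          (m ≠ 0 → ∀ x t : ℝ, 0 < t → EulerKorteweg.massFlux c ρ q x t = m) := by
  obtain ⟨j, hj0, hjm, ε₀, hε₀, H⟩ := hbit.exists_profile hΨ hρs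
  refine ⟨ε₀, hε₀, fun ε hε ω hω hεω c => ?_⟩
  obtain ⟨u, u', l, hu, hu', hp, hmean, hpos, x₁, x₂, hne⟩ := H (ε / ω ^ 2) (by positivity) hεω
  have hR : ∀ x, HasDerivAt (fun x => u (x / ω)) (u' (x / ω) / ω) x := fun x => by
    have := (hu (x / ω)).comp x ((hasDerivAt_id x).div_const ω)
    rwa [mul_one_div] at this
  have hR' : ∀ x, HasDerivAt (fun x => u' (x / ω) / ω)
      ((deriv Ψ (u (x / ω)) + j ^ 2 / (2 * u (x / ω) ^ 2) - l) / ε) x := fun x => by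
    have := ((hu' (x / ω)).comp x ((hasDerivAt_id x).div_const ω)).div_const ω
    convert! this using 1
    field_simp
  have hsol := EulerKorteweg.isSolution_of_profile hΨ hε.ne' hR hR' (fun x => hpos _) c
  have hsurj : ∀ y t, u ((ω * y + c * t - c * t) / ω) = u y := fun y t => by
    rw [add_sub_cancel_right, mul_div_cancel_left₀ _ hω.ne']
  have hper : ∀ x t, u ((x + ω - c * t) / ω) = u ((x - c * t) / ω) := fun x t => by
    rw [← hp ((x - c * t) / ω)]
    congr 1
    field_simp
    ring
  have hflux : ∀ x t, EulerKorteweg.massFlux c (fun x t => u ((x - c * t) / ω))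
      (fun x t => c * u ((x - c * t) / ω) + j) x t = j := fun x t => by
    simp only [EulerKorteweg.massFlux]
    ring
  refine ⟨_, _, hsol, ⟨fun y => u (y / ω), fun y => c * u (y / ω) + j, fun _ _ _ => ⟨rfl, rfl⟩⟩,
    ?_, ?_, ?_, ?_, ?_, ?_⟩
  · intro x t _
    simp only [hper, and_self]
  · intro t _
    have h1 : ∫ x in (0 : ℝ)..ω, u ((x - c * t) / ω) = ω * ρs := by
      rw [intervalIntegral.integral_comp_sub_right (fun x => u (x / ω)) (c * t),
        intervalIntegral.integral_comp_div _ hω.ne', smul_eq_mul, ← hmean]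
      have h2 := hp.intervalIntegral_add_eq ((0 - c * t) / ω) 0
      rw [zero_add] at h2
      rw [← h2]
      congr 2
      field_simp
      ring
    rw [h1]
    field_simp
  · intro h
    exact hj0 ((hflux 0 1).symm.trans (h 0 1 one_pos))
  · rintro t _ ⟨a, ha⟩
    have h1 := ha (ω * x₁ + c * t)
    have h2 := ha (ω * x₂ + c * t)
    simp only [hsurj] at h1 h2
    exact hne (h1.trans h2.symm)
  · rintro t _ ⟨a, ha⟩
    have h1 := (ha (ω * x₁ + c * t)).trans (ha (ω * x₂ + c * t)).symm
    simp only [hsurj] at h1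
    have p1 := hpos x₁
    have p2 := hpos x₂
    rw [div_eq_div_iff p1.ne' p2.ne'] at h1
    exact hne (mul_left_cancel₀ hj0 (by linarith))
  · intro hm x t _
    rw [← hjm hm]
    exact hflux x t
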